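/- **Definitions.** For a partition $\lambda$ with $\ell(\lambda)$ parts (and $\lambda_i=0$ for $i>\ell(\lambda)$) let $\lambda'$ be its conjugate. A skew shape $\lambda/\mu$ (with $\mu\subseteq\lambda$) is the set of cells of the Young diagram of $\lambda$ that are not in that of $\mu$; its size is its number of cells. A *ribbon* is a connected skew shape (any two cells are joined by a chain of cells of the shape in which consecutive cells share an edge) that contains no $2\times 2$ block of cells. For an integer $m\ge 0$ let $\mathcal R_m$ be the set of ribbons $R=\lambda/\mu$ of size $m$ normalized up to translation: each of the $\ell(\lambda)$ rows and each of the $\lambda_1$ columns of $\lambda$ contains a cell of $\lambda/\mu$. (For $m=0$ the empty shape counts as a ribbon, so $\mathcal R_0=\{\emptyset/\emptyset\}$.) For an infinite sequence of variables $\vec x=(x_1,x_2,\dots)$ let $e_d(\vec x)=\sum_{i_1<\dots<i_d}x_{i_1}\cdots x_{i_d}$ for $d>0$, $e_0=1$, $e_d=0$ for $d<0$. For $R=\lambda/\mu$ put $$\mathrm{JT}_{R}(\vec x)=\bigl(e_{\lambda_i-\mu_j-i+j}(\vec x)\bigr)_{i,j=1}^{\ell(\lambda)},$$ let $s_\lambda(\vec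 x)=\det\bigl(e_{\lambda'_i-i+j}(\vec x)\bigr)_{i,j=1}^{\lambda_1}$ be the Schur function, let $f^\lambda$ be the number of standard Young tableaux of shape $\lambda$, and let $*$ be the Hadamard (entrywise) product of matrices. Determinants are taken in the ring of formal power series over $\mathbb Q$ in all the variables of the alphabets that occur. **Proposition.** Let $k\ge 1$ and $m\ge 0$ be integers and let $\vec x^{(1)},\dots,\vec x^{(k)}$ be $k$ disjoint infinite sequences of variables. The set $\mathcal R_m$ is finite and $$\sum_{R\in\mathcal R_m}\det\left(\mathrm{JT}_R(\vec x^{(1)})*\cdots*\mathrm{JT}_R(\vec x^{(k)})\right)=\prod_{i=1}^k\Bigl(\sum_{\lambda\vdash m}f^\lambda s_\lambda(\vec x^{(i)})\Bigr).$$ Moreover, the coefficient of $\prod_{i=1}^k x^{(i)}_1x^{(i)}_2\cdots x^{(i)}_m$ on either side is $(m!)^k$. -/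

import Mathlib

noncomputable section

namespace HadamardJT

/-! ### Skew shapes and ribbons

Young diagrams are Mathlib's `YoungDiagram`; rows and columns are numbered from `0`, so
`mu.rowLen i` is the part of index `i + 1`, and `mu.colLen 0` is the number of parts. -/

/-- A skew shape `outer / inner`. -/
@[ext]
structure SkewShape where
  outer : YoungDiagram
  inner : YoungDiagram
  le : inner ≤ outer

namespace SkewShape

/-- The cells of a skew shape: the set-theoretic difference of the two diagrams. -/
def cells (R : SkewShape) : Finset (ℕ × ℕ) := R.outer.cells \ R.inner.cells

/-- The number of cells. -/
def size (R : SkewShape) : ℕ := R.cells.card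

/-- Two cells share an edge. -/
def Adjacent (c d : ℕ × ℕ) : Prop :=
  (c.1 = d.1 ∧ (c.2 + 1 = d.2 ∨ d.2 + 1 = c.2)) ∨
  (c.2 = d.2 ∧ (c.1 + 1 = d.1 ∨ d.1 + 1 = c.1))

/-- Any two cells are joined by a chain of adjacent cells of the shape. -/
def Connected (R : SkewShape) : Prop :=
  ∀ c ∈ R.cells, ∀ d ∈ R.cells,
    Relation.ReflTransGen (fun a b => a ∈ R.cells ∧ b ∈ R.cells ∧ Adjacent a b) c d

/-- The shape contains a `2 × 2` block of cells. -/
def HasTwoByTwoBlock (R : SkewShape) : Prop :=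
  ∃ i j : ℕ, (i, j) ∈ R.cells ∧ (i, j + 1) ∈ R.cells ∧
    (i + 1, j) ∈ R.cells ∧ (i + 1, j + 1) ∈ R.cells

/-- A ribbon: a connected skew shape without a `2 × 2` block. -/
def IsRibbon (R : SkewShape) : Prop := R.Connected ∧ ¬ R.HasTwoByTwoBlock

/-- The shape meets each of the rows and each of the columns of its outer diagram. This selects one
representative of every connected shape up to vertical and horizontal translation. -/
def IsNormalized (R : SkewShape) : Prop :=
  {i : ℕ | R.inner.rowLen i < R.outer.rowLen i} = Set.Iio (R.outer.colLen 0) ∧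
  {j : ℕ | R.inner.colLen j < R.outer.colLen j} = Set.Iio (R.outer.rowLen 0)

end SkewShape

theorem finite_setOf_cells_subset (S : Finset (ℕ × ℕ)) :
    {mu : YoungDiagram | mu.cells ⊆ S}.Finite := by
  refine Set.Finite.of_finite_image (f := YoungDiagram.cells)
    (S.powerset.finite_toSet.subset ?_) ?_
  · rintro _ ⟨mu, hmu, rfl⟩
    simpa using hmu
  · intro a _ b _ h
    exact YoungDiagram.ext h

theorem finite_setOf_card_eq (m : ℕ) : {mu : YoungDiagram | mu.card = m}.Finite := by
  refine (finite_setOf_cells_subset (Finset.range m ×ˢ Finset.range m)).subset ?_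
  rintro mu rfl ⟨i, j⟩ hc
  rw [YoungDiagram.mem_cells] at hc
  simp only [Finset.mem_product, Finset.mem_range]
  constructor
  · refine (YoungDiagram.mem_iff_lt_colLen.1 hc).trans_le ?_
    rw [YoungDiagram.colLen_eq_card]
    exact Finset.card_le_card (Finset.filter_subset _ _)
  · refine (YoungDiagram.mem_iff_lt_rowLen.1 hc).trans_le ?_
    rw [YoungDiagram.rowLen_eq_card]
    exact Finset.card_le_card (Finset.filter_subset _ _)

/-- The partitions of `m`, as Young diagrams. -/
def partitionsOf (m : ℕ) : Finset YoungDiagram := (finite_setOf_card_eq m).toFinset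

theorem finite_setOf_normalized (m : ℕ) :
    {R : SkewShape | R.IsNormalized ∧ R.size = m}.Finite := by
  have hB := finite_setOf_cells_subset (Finset.range m ×ˢ Finset.range m)
  refine Set.Finite.of_finite_image (f := fun R : SkewShape => (R.outer, R.inner))
    ((hB.prod hB).subset ?_) ?_
  · rintro _ ⟨R, ⟨⟨h1, h2⟩, rfl⟩, rfl⟩
    have hr : R.outer.colLen 0 ≤ R.size := by
      have := Finset.card_le_card_of_injOn (s := Finset.range (R.outer.colLen 0)) (t := R.cells)
        (fun i => (i, R.inner.rowLen i)) (by
          intro i hi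
          have hi' : i ∈ Set.Iio (R.outer.colLen 0) := by simpa using hi
          rw [← h1] at hi'
          simpa [SkewShape.cells, YoungDiagram.mem_iff_lt_rowLen] using hi')
        (by intro a _ b _ h; exact congrArg Prod.fst h)
      simpa [SkewShape.size] using this
    have hc : R.outer.rowLen 0 ≤ R.size := by
      have := Finset.card_le_card_of_injOn (s := Finset.range (R.outer.rowLen 0)) (t := R.cells)
        (fun j => (R.inner.colLen j, j)) (by
          intro j hj
          have hj' : j ∈ Set.Iio (R.outer.rowLen 0) := by simpa using hj
          rw [← h2] at hj'
          simpa [SkewShape.cells, YoungDiagram.mem_iff_lt_colLen] using hj')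
        (by intro a _ b _ h; exact congrArg Prod.snd h)
      simpa [SkewShape.size] using this
    have ho : R.outer.cells ⊆ Finset.range R.size ×ˢ Finset.range R.size := by
      rintro ⟨i, j⟩ hij
      rw [YoungDiagram.mem_cells] at hij
      simp only [Finset.mem_product, Finset.mem_range]
      exact ⟨((YoungDiagram.mem_iff_lt_colLen.1 hij).trans_le
          (R.outer.colLen_anti 0 j (Nat.zero_le _))).trans_le hr,
        ((YoungDiagram.mem_iff_lt_rowLen.1 hij).trans_le
          (R.outer.rowLen_anti 0 i (Nat.zero_le _))).trans_le hc⟩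
    exact ⟨ho, (YoungDiagram.cells_subset_iff.2 R.le).trans ho⟩
  · intro a _ b _ h
    exact SkewShape.ext (congrArg Prod.fst h) (congrArg Prod.snd h)

theorem finite_setOf_ribbon (m : ℕ) :
    {R : SkewShape | R.IsRibbon ∧ R.IsNormalized ∧ R.size = m}.Finite :=
  (finite_setOf_normalized m).subset fun _ h => h.2

/-- The ribbons of size `m`, up to translation. -/
def ribbons (m : ℕ) : Finset SkewShape := (finite_setOf_ribbon m).toFinset

/-! ### Standard Young tableaux -/

/-- A tableau is standard if each of `1, …, |mu|` appears exactly once. -/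
def IsStandard {mu : YoungDiagram} (T : SemistandardYoungTableau mu) : Prop :=
  Set.BijOn (fun c : ℕ × ℕ => T c.1 c.2) (mu.cells : Set (ℕ × ℕ)) (Set.Icc 1 mu.card)

/-- The number of standard Young tableaux of shape `mu`. -/
def numSYT (mu : YoungDiagram) : ℕ :=
  Nat.card {T : SemistandardYoungTableau mu // IsStandard T}

/-! ### Symmetric functions

Symmetric functions live in the ring of formal power series over `ℚ` in variables indexed by `ℕ`;
the variable of index `j` plays the role of `x_{j+1}`. -/

open Classical in
/-- The elementary symmetric function `e_d`, the sum of all squarefree monomials of degree `d`.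
It is `1` for `d = 0` and `0` for `d < 0`. -/
def elemSymm (d : ℤ) : MvPowerSeries ℕ ℚ :=
  fun a => if (∀ j, a j ≤ 1) ∧ (a.degree : ℤ) = d then 1 else 0

/-- The (dual) Jacobi--Trudi matrix `(e_{λ_i - μ_j - i + j})`, with one row for each part of the
outer partition. -/
def jacobiTrudi (R : SkewShape) :
    Matrix (Fin (R.outer.colLen 0)) (Fin (R.outer.colLen 0)) (MvPowerSeries ℕ ℚ) :=
  Matrix.of fun i j =>
    elemSymm ((R.outer.rowLen i : ℤ) - (R.inner.rowLen j : ℤ) - (i : ℤ) + (j : ℤ))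

/-- The Schur function `s_λ = det (e_{λ'_i - i + j})`, where `λ'` is the conjugate partition. -/
def schur (mu : YoungDiagram) : MvPowerSeries ℕ ℚ :=
  (jacobiTrudi ⟨mu.transpose, ⊥, bot_le⟩).det

/-! ### Several alphabets -/

instance tendstoCofinite_prodMk {k : ℕ} (i : Fin k) :
    Filter.TendstoCofinite (fun j : ℕ => (i, j)) :=
  Filter.tendstoCofinite_of_injective (Prod.mk_right_injective i)

/-- Write a power series in the alphabet of index `i`: `f ↦ f(x^(i))`. The variable of index
`(i, j)` plays the role of `x^(i)_{j+1}`. -/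
def inAlphabet {k : ℕ} (i : Fin k) :
    MvPowerSeries ℕ ℚ →ₐ[ℚ] MvPowerSeries (Fin k × ℕ) ℚ :=
  MvPowerSeries.rename (fun j : ℕ => (i, j))

/-- The Hadamard (entrywise) product `A(x^(1)) * ⋯ * A(x^(k))` of the copies of one matrix
in the `k` alphabets. -/
def hadamardPower (k : ℕ) {n : ℕ} (A : Matrix (Fin n) (Fin n) (MvPowerSeries ℕ ℚ)) :
    Matrix (Fin n) (Fin n) (MvPowerSeries (Fin k × ℕ) ℚ) :=
  Matrix.of fun a b => ∏ i : Fin k, inAlphabet i (A a b)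

/-- The exponent of the monomial `∏_i x^(i)_1 ⋯ x^(i)_m`. -/
def allOnes (k m : ℕ) : Fin k × ℕ →₀ ℕ :=
  ∑ i : Fin k, ∑ j ∈ Finset.range m, Finsupp.single (i, j) 1

end HadamardJT

end

open HadamardJT

/-!
The normalized ribbons are the rims of the Young diagrams, the rim consisting of the cells whose
south-east neighbour is not in the diagram. Every ribbon of size `m + 1` arises from a unique ribbon
of size `m` either by repeating the first row of the diagram, if it is not empty, or by lengthening
that row by one cell. Put `g d = ∏ i, e_d(x^(i))`, so that the left-hand side sums the determinants
`det (g (λ_i - μ_j - i + j))`. Since `g 0 = 1` and `g d = 0` for `d < 0`, expanding along the first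
column shows that the determinants of the two extensions of a ribbon add up to `g 1` times the
determinant of the ribbon. Hence the left-hand side is `g 1 ^ m = ∏ i, e_1(x^(i)) ^ m`.

On the right-hand side, the Pieri rule `e_1 s_μ = ∑ s_λ`, over the diagrams `λ` obtained from `μ` by
adding a cell, and the branching rule `f^λ = ∑ f^μ`, over the diagrams `μ` obtained from `λ` by
removing a cell, give `∑ f^λ s_λ = e_1 ^ m` by induction on `m`. The Pieri rule holds because
raising the row indices of a determinant one at a time has the same total effect as lowering the
column indices one at a time.
-/

namespace HadamardJT

/-! ### Determinants of the form `det (g (a i - b j))` -/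

section Determinants

variable {A ι : Type*} [CommRing A] [Fintype ι] [DecidableEq ι]

theorem sum_det_updateRow_eq_sum_det_updateCol (M N : Matrix ι ι A) :
    ∑ i, (M.updateRow i (N i)).det = ∑ j, (M.updateCol j fun i => N i j).det := by
  have det_updateRow_eq (i : ι) :
      (M.updateRow i (N i)).det = ∑ j, N i j * M.adjugate j i := by
    rw [← Matrix.cramer_transpose_apply, Matrix.cramer_eq_adjugate_mulVec,
      ← Matrix.adjugate_transpose]
    simp [Matrix.mulVec, dotProduct, mul_comm]
  have det_updateCol_eq (j : ι) :
      (M.updateCol j fun i => N i j).det = ∑ i, N i j * M.adjugate j i := by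
    rw [← Matrix.cramer_apply, Matrix.cramer_eq_adjugate_mulVec]
    simp [Matrix.mulVec, dotProduct, mul_comm]
  simp only [det_updateRow_eq, det_updateCol_eq]
  exact Finset.sum_comm

theorem det_eq_mul_of_last_row_eq_zero {n : ℕ} (M : Matrix (Fin (n + 1)) (Fin (n + 1)) A)
    (h : ∀ j : Fin n, M (Fin.last n) j.castSucc = 0) :
    M.det = M (Fin.last n) (Fin.last n) * (M.submatrix Fin.castSucc Fin.castSucc).det := by
  rw [Matrix.det_succ_row M (Fin.last n), Fin.sum_univ_castSucc]
  simp [h, ← two_mul, pow_mul]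

theorem det_eq_sub_of_first_col_eq_zero {n : ℕ} (M : Matrix (Fin (n + 2)) (Fin (n + 2)) A)
    (h : ∀ i : Fin n, M i.succ.succ 0 = 0) :
    M.det = M 0 0 * (M.submatrix Fin.succ Fin.succ).det -
      M 1 0 * (M.submatrix (Fin.succAbove 1) Fin.succ).det := by
  rw [Matrix.det_succ_column_zero, Fin.sum_univ_succ, Fin.sum_univ_succ]
  simp [h, sub_eq_add_neg]

/-- The determinant of the matrix `(g (a i - b j))` with `i, j < n`. For `a i = λ_i - i` and
`b j = μ_j - j` this is the Jacobi--Trudi determinant of `λ / μ` over the sequence `g`. -/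
def jtDet (g : ℤ → A) (n : ℕ) (a b : ℕ → ℤ) : A :=
  (Matrix.of fun i j : Fin n => g (a i - b j)).det

variable {g : ℤ → A} {n : ℕ} {a b : ℕ → ℤ}

theorem jtDet_zero : jtDet g 0 a b = 1 :=
  Matrix.det_fin_zero

theorem jtDet_congr {a' b' : ℕ → ℤ} (h : ∀ i < n, ∀ j < n, a i - b j = a' i - b' j) :
    jtDet g n a b = jtDet g n a' b' := by
  unfold jtDet
  congr 2
  ext i j
  rw [h i i.2 j j.2]

theorem jtDet_eq_zero_of_row_eq {i j : ℕ} (hi : i < n) (hj : j < n) (hij : i ≠ j)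
    (h : a i = a j) : jtDet g n a b = 0 :=
  Matrix.det_zero_of_row_eq (i := ⟨i, hi⟩) (j := ⟨j, hj⟩) (by simpa using hij)
    (funext fun _ => by simp only [Matrix.of_apply, h])

theorem jtDet_eq_zero_of_col_eq {i j : ℕ} (hi : i < n) (hj : j < n) (hij : i ≠ j)
    (h : b i = b j) : jtDet g n a b = 0 :=
  Matrix.det_zero_of_column_eq (i := ⟨i, hi⟩) (j := ⟨j, hj⟩) (by simpa using hij)
    fun _ => by simp only [Matrix.of_apply, h]

theorem jtDet_succ_of_last_row_eq_zero (h : ∀ j < n, g (a n - b j) = 0) :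
    jtDet g (n + 1) a b = g (a n - b n) * jtDet g n a b := by
  unfold jtDet
  rw [det_eq_mul_of_last_row_eq_zero _ fun j => by simpa using h j j.2]
  simp only [Matrix.of_apply, Fin.val_last]
  rfl

theorem jtDet_succ_succ_of_first_col_eq_zero (h : ∀ i < n, g (a (i + 2) - b 0) = 0) :
    jtDet g (n + 2) a b =
      g (a 0 - b 0) * jtDet g (n + 1) (fun i => a (i + 1)) (fun j => b (j + 1)) -
      g (a 1 - b 0) *
        jtDet g (n + 1) (Function.update (fun i => a (i + 1)) 0 (a 0)) (fun j => b (j + 1)) := by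
  unfold jtDet
  rw [det_eq_sub_of_first_col_eq_zero _ fun i => by simpa using h i i.2]
  congr 3
  ext i j
  cases i using Fin.cases <;> simp

theorem sum_jtDet_raise_row_eq_sum_jtDet_lower_col (g : ℤ → A) (n : ℕ) (a b : ℕ → ℤ) :
    ∑ i ∈ Finset.range n, jtDet g n (Function.update a i (a i + 1)) b =
      ∑ j ∈ Finset.range n, jtDet g n a (Function.update b j (b j - 1)) := by
  rw [Finset.sum_range, Finset.sum_range]
  convert sum_det_updateRow_eq_sum_det_updateCol
    (Matrix.of fun i j : Fin n => g (a i - b j)) (Matrix.of fun i j => g (a i + 1 - b j)) using 2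
  · rename_i i _
    unfold jtDet
    congr 1
    ext r c
    by_cases h : r = i <;> simp [Matrix.updateRow_apply, Function.update_apply, Fin.val_inj, h]
  · rename_i j _
    unfold jtDet
    congr 1
    ext r c
    by_cases h : c = j <;>
      simp [Function.update_apply, Fin.val_inj, h, sub_sub_eq_add_sub,
        add_sub_right_comm]

theorem jtDet_succ_of_eq_neg (hneg : ∀ d < 0, g d = 0) (hzero : g 0 = 1) (ha : a n = -n) :
    jtDet g (n + 1) a (fun j => -j) = jtDet g n a (fun j => -j) := by
  rw [jtDet_succ_of_last_row_eq_zero fun j hj => hneg _ (by omega)]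
  simp [ha, hzero]

theorem mul_jtDet_eq_sum_raise_row (hneg : ∀ d < 0, g d = 0) (ha : a n = -n) :
    g 1 * jtDet g n a (fun j => -j) =
      ∑ i ∈ Finset.range (n + 1), jtDet g (n + 1) (Function.update a i (a i + 1)) fun j => -j := by
  have equal_cols (j : ℕ) (hj : j ∈ Finset.range n) :
      jtDet g (n + 1) a (Function.update (fun j => -j : ℕ → ℤ) j (-j - 1)) = 0 := by
    rw [Finset.mem_range] at hj
    refine jtDet_eq_zero_of_col_eq (i := j) (j := j + 1) (by omega) (by omega) (by omega) ?_
    rw [Function.update_self, Function.update_of_ne (by omega)]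
    push_cast
    ring
  rw [sum_jtDet_raise_row_eq_sum_jtDet_lower_col, Finset.sum_range_succ,
    Finset.sum_eq_zero equal_cols, zero_add, jtDet_succ_of_last_row_eq_zero]
  · rw [Function.update_self, ha]
    congr 1
    · congr 1
      ring
    · exact jtDet_congr fun i _ j hj => by rw [Function.update_of_ne hj.ne]
  · intro j hj
    rw [Function.update_of_ne hj.ne, ha]
    exact hneg _ (by omega)

end Determinants

/-! ### Young diagrams and their row lengths -/

section RowLengths

variable {mu : YoungDiagram}

theorem rowLen_injective : Function.Injective YoungDiagram.rowLen := fun _ _ h =>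
  SetLike.ext fun ⟨_, _⟩ => by
    rw [YoungDiagram.mem_iff_lt_rowLen, YoungDiagram.mem_iff_lt_rowLen, h]

theorem rowLen_bot : (⊥ : YoungDiagram).rowLen = 0 :=
  funext fun i => by simp [YoungDiagram.rowLen_eq_card, YoungDiagram.row]

theorem lt_colLen_iff_lt_rowLen {i j : ℕ} : i < mu.colLen j ↔ j < mu.rowLen i :=
  YoungDiagram.mem_iff_lt_colLen.symm.trans YoungDiagram.mem_iff_lt_rowLen

theorem rowLen_eq_zero_iff {i : ℕ} : mu.rowLen i = 0 ↔ mu.colLen 0 ≤ i := by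
  rw [← not_lt, lt_colLen_iff_lt_rowLen, Nat.pos_iff_ne_zero, not_not]

theorem rowLen_zero_pos_iff : 0 < mu.rowLen 0 ↔ mu ≠ ⊥ := by
  refine ⟨?_, fun h => Nat.pos_of_ne_zero fun h0 => h (rowLen_injective ?_)⟩
  · rintro h rfl
    simp [rowLen_bot] at h
  · rw [rowLen_bot]
    exact funext fun i => Nat.eq_zero_of_le_zero (h0 ▸ mu.rowLen_anti 0 i i.zero_le)

theorem colLen_zero_pos_iff : 0 < mu.colLen 0 ↔ mu ≠ ⊥ :=
  lt_colLen_iff_lt_rowLen.trans rowLen_zero_pos_iff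

theorem colLen_zero_bot : (⊥ : YoungDiagram).colLen 0 = 0 :=
  Nat.eq_zero_of_not_pos (colLen_zero_pos_iff.not.2 (not_not.2 rfl))

theorem card_eq_sum_rowLen {n : ℕ} (hn : mu.rowLen n = 0) :
    mu.card = ∑ i ∈ Finset.range n, mu.rowLen i := by
  simp only [YoungDiagram.rowLen_eq_card, YoungDiagram.row]
  refine Finset.card_eq_sum_card_fiberwise fun c hc => ?_
  by_contra hcn
  have hlt := YoungDiagram.mem_iff_lt_rowLen.1 (show (c.1, c.2) ∈ mu from hc)
  have hle := mu.rowLen_anti n c.1 (by simpa using hcn)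
  omega

/-- The Young diagram whose row lengths are the values of an antitone, eventually zero sequence. -/
def ofRowLen (f : ℕ → ℕ) (hf : Antitone f) (h0 : ∃ n, f n = 0) : YoungDiagram where
  cells := (Finset.range (Nat.find h0) ×ˢ Finset.range (f 0)).filter fun c => c.2 < f c.1
  isLowerSet := by
    rintro ⟨i, j⟩ ⟨i', j'⟩ ⟨hi : i' ≤ i, hj : j' ≤ j⟩ h
    simp only [Finset.coe_filter, Finset.mem_product, Finset.mem_range, Set.mem_ofPred_eq] at h ⊢
    exact ⟨⟨hi.trans_lt h.1.1, hj.trans_lt h.1.2⟩, hj.trans_lt (h.2.trans_le (hf hi))⟩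

theorem rowLen_ofRowLen {f : ℕ → ℕ} (hf : Antitone f) (h0 : ∃ n, f n = 0) :
    (ofRowLen f hf h0).rowLen = f := by
  refine funext fun i => eq_of_forall_lt_iff fun j => ?_
  rw [← YoungDiagram.mem_iff_lt_rowLen, ← YoungDiagram.mem_cells]
  simp only [ofRowLen, Finset.mem_filter, Finset.mem_product, Finset.mem_range,
    and_iff_right_iff_imp]
  refine fun h => ⟨?_, h.trans_le (hf i.zero_le)⟩
  by_contra hi
  have := hf (not_lt.1 hi)
  rw [Nat.find_spec h0] at this
  omega

/-- The diagram `mu` with one more cell in row `i`, where row `i` is shorter than the row above. -/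
def addCell (mu : YoungDiagram) (i : ℕ) (h : ∀ j, j + 1 = i → mu.rowLen i < mu.rowLen j) :
    YoungDiagram :=
  ofRowLen (Function.update mu.rowLen i (mu.rowLen i + 1))
    (antitone_nat_of_succ_le fun j => by
      have := mu.rowLen_anti j (j + 1) j.le_succ
      have := h j
      simp only [Function.update_apply]
      split_ifs <;> grind)
    ⟨max (i + 1) (mu.colLen 0), by
      rw [Function.update_of_ne (by omega), rowLen_eq_zero_iff.2 (le_max_right _ _)]⟩

theorem rowLen_addCell {i : ℕ} (h : ∀ j, j + 1 = i → mu.rowLen i < mu.rowLen j) :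
    (addCell mu i h).rowLen = Function.update mu.rowLen i (mu.rowLen i + 1) :=
  rowLen_ofRowLen _ _

end RowLengths

/-! ### Ribbons are rims -/

section Rims

/-- The diagram `mu` without its first row and its first column, that is, without its first hook. -/
def removeFirstHook (mu : YoungDiagram) : YoungDiagram :=
  ofRowLen (fun i => mu.rowLen (i + 1) - 1)
    (fun _ _ h => Nat.sub_le_sub_right (mu.rowLen_anti _ _ (Nat.succ_le_succ h)) 1)
    ⟨mu.colLen 0, by rw [rowLen_eq_zero_iff.2 (Nat.le_succ _)]⟩

variable {mu : YoungDiagram} {R : SkewShape} {i j : ℕ}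

theorem rowLen_removeFirstHook : (removeFirstHook mu).rowLen i = mu.rowLen (i + 1) - 1 :=
  congrFun (rowLen_ofRowLen _ _) i

theorem mem_removeFirstHook : (i, j) ∈ removeFirstHook mu ↔ (i + 1, j + 1) ∈ mu := by
  rw [YoungDiagram.mem_iff_lt_rowLen, YoungDiagram.mem_iff_lt_rowLen, rowLen_removeFirstHook,
    Nat.lt_sub_iff_add_lt]

theorem colLen_removeFirstHook : (removeFirstHook mu).colLen j = mu.colLen (j + 1) - 1 :=
  eq_of_forall_lt_iff fun i => by
    rw [← YoungDiagram.mem_iff_lt_colLen, mem_removeFirstHook, YoungDiagram.mem_iff_lt_colLen,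
      Nat.lt_sub_iff_add_lt]

/-- The rim of `mu`: the cells `(i, j)` of `mu` for which `(i + 1, j + 1)` is not a cell. -/
def rimShape (mu : YoungDiagram) : SkewShape where
  outer := mu
  inner := removeFirstHook mu
  le := fun ⟨i, j⟩ h => mu.up_left_mem i.le_succ j.le_succ (mem_removeFirstHook.1 h)

theorem SkewShape.mem_cells {c : ℕ × ℕ} : c ∈ R.cells ↔ c ∈ R.outer ∧ c ∉ R.inner := by
  simp [SkewShape.cells]

theorem mem_cells_rimShape : (i, j) ∈ (rimShape mu).cells ↔ (i, j) ∈ mu ∧ (i + 1, j + 1) ∉ mu := by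
  rw [SkewShape.mem_cells, ← mem_removeFirstHook]
  rfl

theorem SkewShape.Adjacent.symm {c d : ℕ × ℕ} (h : SkewShape.Adjacent c d) :
    SkewShape.Adjacent d c := by
  unfold SkewShape.Adjacent at h ⊢
  omega

/-- The walk along the rim goes east where it can and north elsewhere. -/
theorem reflTransGen_rimShape {c : ℕ × ℕ} (hc : c ∈ (rimShape mu).cells) :
    Relation.ReflTransGen
      (fun a b => a ∈ (rimShape mu).cells ∧ b ∈ (rimShape mu).cells ∧ SkewShape.Adjacent a b)
      c (0, mu.rowLen 0 - 1) := by
  obtain ⟨i, j⟩ := c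
  induction hn : i + (mu.rowLen 0 - j) generalizing i j with
  | zero =>
    have := YoungDiagram.mem_iff_lt_rowLen.1 (mem_cells_rimShape.1 hc).1
    have := mu.rowLen_anti 0 i i.zero_le
    omega
  | succ n ih =>
    obtain ⟨hmem, hdiag⟩ := mem_cells_rimShape.1 hc
    by_cases heast : (i, j + 1) ∈ mu
    · have hrim : (i, j + 1) ∈ (rimShape mu).cells :=
        mem_cells_rimShape.2 ⟨heast, fun h => hdiag (mu.up_left_mem le_rfl (Nat.le_succ _) h)⟩
      have := YoungDiagram.mem_iff_lt_rowLen.1 heast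
      have := mu.rowLen_anti 0 i i.zero_le
      exact .head ⟨hc, hrim, .inl ⟨rfl, .inl rfl⟩⟩ (ih i (j + 1) hrim (by omega))
    · cases i with
      | zero =>
        rw [YoungDiagram.mem_iff_lt_rowLen] at hmem heast
        rw [show mu.rowLen 0 - 1 = j by omega]
      | succ i =>
        have hrim : (i, j) ∈ (rimShape mu).cells :=
          mem_cells_rimShape.2 ⟨mu.up_left_mem i.le_succ le_rfl hmem, heast⟩
        exact .head ⟨hc, hrim, .inr ⟨rfl, .inr rfl⟩⟩ (ih i j hrim (by omega))

theorem connected_rimShape : (rimShape mu).Connected := fun _ hc _ hd => by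
  have : Std.Symm fun a b =>
      a ∈ (rimShape mu).cells ∧ b ∈ (rimShape mu).cells ∧ SkewShape.Adjacent a b :=
    ⟨fun _ _ h => ⟨h.2.1, h.1, h.2.2.symm⟩⟩
  exact (reflTransGen_rimShape hc).trans (symm (reflTransGen_rimShape hd))

theorem isRibbon_rimShape : (rimShape mu).IsRibbon := by
  refine ⟨connected_rimShape, ?_⟩
  rintro ⟨i, j, hc, -, -, hd⟩
  exact (mem_cells_rimShape.1 hc).2 (mem_cells_rimShape.1 hd).1

theorem isNormalized_rimShape : (rimShape mu).IsNormalized := by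
  constructor
  · ext i
    have : i < mu.colLen 0 ↔ 0 < mu.rowLen i := lt_colLen_iff_lt_rowLen
    have := mu.rowLen_anti i (i + 1) i.le_succ
    change (removeFirstHook mu).rowLen i < mu.rowLen i ↔ i < mu.colLen 0
    rw [rowLen_removeFirstHook]
    omega
  · ext j
    have : 0 < mu.colLen j ↔ j < mu.rowLen 0 := lt_colLen_iff_lt_rowLen
    have := mu.colLen_anti j (j + 1) j.le_succ
    change (removeFirstHook mu).colLen j < mu.colLen j ↔ j < mu.rowLen 0
    rw [colLen_removeFirstHook]
    omega

theorem SkewShape.size_add_card_inner : R.size + R.inner.card = R.outer.card :=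
  Finset.card_sdiff_add_card_eq_card (YoungDiagram.cells_subset_iff.2 R.le)

theorem size_rimShape_add_one (h : mu ≠ ⊥) :
    (rimShape mu).size + 1 = mu.rowLen 0 + mu.colLen 0 := by
  obtain ⟨n, hn⟩ := Nat.exists_eq_succ_of_ne_zero (colLen_zero_pos_iff.2 h).ne'
  have hlast : mu.rowLen (n + 1) = 0 := rowLen_eq_zero_iff.2 hn.le
  have houter : mu.card = ∑ i ∈ Finset.range n, mu.rowLen (i + 1) + mu.rowLen 0 := by
    rw [card_eq_sum_rowLen hlast, Finset.sum_range_succ']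
  have hinner : (removeFirstHook mu).card + n = ∑ i ∈ Finset.range n, mu.rowLen (i + 1) := by
    have hcount : n = ∑ i ∈ Finset.range n, 1 := by simp
    rw [card_eq_sum_rowLen (n := n) (by rw [rowLen_removeFirstHook, hlast])]
    nth_rw 2 [hcount]
    rw [← Finset.sum_add_distrib]
    refine Finset.sum_congr rfl fun i hi => ?_
    have : 0 < mu.rowLen (i + 1) :=
      lt_colLen_iff_lt_rowLen.1 (by rw [hn]; have := Finset.mem_range.1 hi; omega)
    rw [rowLen_removeFirstHook]
    omega
  have hsize : (rimShape mu).size + (removeFirstHook mu).card = mu.card :=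
    SkewShape.size_add_card_inner
  omega

theorem SkewShape.Connected.of_adjacent_imp (hR : R.Connected) {P : ℕ × ℕ → Prop}
    (hP : ∀ c ∈ R.cells, ∀ d ∈ R.cells, SkewShape.Adjacent c d → P c → P d) {c d : ℕ × ℕ}
    (hc : c ∈ R.cells) (hd : d ∈ R.cells) (h : P c) : P d := by
  induction hR c hc d hd with
  | refl => exact h
  | tail _ hstep ih => exact hP _ hstep.1 _ hstep.2.1 hstep.2.2 (ih hstep.1)

theorem SkewShape.IsNormalized.mk_rowLen_mem_cells (hR : R.IsNormalized) (h : (i, j) ∈ R.outer) :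
    (i, R.inner.rowLen i) ∈ R.cells := by
  have hi : i ∈ {i | R.inner.rowLen i < R.outer.rowLen i} := by
    rw [hR.1]
    exact YoungDiagram.mem_iff_lt_colLen.1 (R.outer.up_left_mem le_rfl j.zero_le h)
  rw [mem_cells, YoungDiagram.mem_iff_lt_rowLen, YoungDiagram.mem_iff_lt_rowLen]
  exact ⟨hi, lt_irrefl _⟩

theorem SkewShape.IsNormalized.colLen_mk_mem_cells (hR : R.IsNormalized) (h : (i, j) ∈ R.outer) :
    (R.inner.colLen j, j) ∈ R.cells := by
  have hj : j ∈ {j | R.inner.colLen j < R.outer.colLen j} := by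
    rw [hR.2]
    exact YoungDiagram.mem_iff_lt_rowLen.1 (R.outer.up_left_mem i.zero_le le_rfl h)
  rw [mem_cells, YoungDiagram.mem_iff_lt_colLen, YoungDiagram.mem_iff_lt_colLen]
  exact ⟨hj, lt_irrefl _⟩

/-- Otherwise the cells of `R` lie strictly north-east or strictly south-west of the corner between
`(i, j)` and `(i + 1, j + 1)`, with cells on both sides but no edge between the two parts. -/
theorem SkewShape.succ_succ_mem_outer_of_mem_inner (hconn : R.Connected) (hnorm : R.IsNormalized)
    (h : (i, j) ∈ R.inner) : (i + 1, j + 1) ∈ R.outer := by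
  by_contra hout
  have hsplit (a b : ℕ) (hab : (a, b) ∈ R.cells) : (a ≤ i ∧ j < b) ∨ (i < a ∧ b ≤ j) := by
    rw [mem_cells] at hab
    by_contra hcon
    rcases le_or_gt a i with ha | ha
    · exact hab.2 (R.inner.up_left_mem ha (by omega) h)
    · exact hout (R.outer.up_left_mem (show i + 1 ≤ a from ha) (by omega) hab.1)
  have hnorth : R.inner.colLen j ≤ i := by
    refine hconn.of_adjacent_imp (P := fun c => c.1 ≤ i) (fun c hc d hd hcd hci => ?_)
      (hnorm.mk_rowLen_mem_cells (R.le h)) (hnorm.colLen_mk_mem_cells (R.le h)) le_rfl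
    have := hsplit _ _ hc
    have := hsplit _ _ hd
    unfold SkewShape.Adjacent at hcd
    omega
  exact (YoungDiagram.mem_iff_lt_colLen.1 h).not_ge hnorth

theorem SkewShape.mem_inner_of_succ_succ_mem_outer (hR : ¬R.HasTwoByTwoBlock)
    (h : (i + 1, j + 1) ∈ R.outer) : (i, j) ∈ R.inner := by
  by_contra hin
  have hmem (a b : ℕ) (hia : i ≤ a) (hai : a ≤ i + 1) (hjb : j ≤ b) (hbj : b ≤ j + 1) :
      (a, b) ∈ R.cells :=
    mem_cells.2 ⟨R.outer.up_left_mem hai hbj h, fun hab => hin (R.inner.up_left_mem hia hjb hab)⟩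
  exact hR ⟨i, j, by apply hmem <;> omega, by apply hmem <;> omega, by apply hmem <;> omega,
    by apply hmem <;> omega⟩

theorem SkewShape.IsRibbon.eq_rimShape (hR : R.IsRibbon) (hnorm : R.IsNormalized) :
    R = rimShape R.outer :=
  SkewShape.ext rfl <| SetLike.ext fun ⟨_, _⟩ =>
    Iff.trans ⟨succ_succ_mem_outer_of_mem_inner hR.1 hnorm, mem_inner_of_succ_succ_mem_outer hR.2⟩
      mem_removeFirstHook.symm

theorem rimShape_mem_ribbons {m : ℕ} : rimShape mu ∈ ribbons m ↔ (rimShape mu).size = m := by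
  simp [ribbons, isRibbon_rimShape, isNormalized_rimShape]

theorem mem_ribbons {m : ℕ} : R ∈ ribbons m ↔ ∃ mu, (rimShape mu).size = m ∧ rimShape mu = R := by
  constructor
  · intro hR
    have hRm : R.IsRibbon ∧ R.IsNormalized ∧ R.size = m := by simpa [ribbons] using hR
    have hrim := hRm.1.eq_rimShape hRm.2.1
    exact ⟨R.outer, hrim ▸ hRm.2.2, hrim.symm⟩
  · rintro ⟨mu, hmu, rfl⟩
    exact rimShape_mem_ribbons.2 hmu

end Rims

/-! ### Growing a ribbon by one cell -/

section Growth

/-- The diagram `mu` with its first row repeated. For `mu ≠ ⊥` this adds a cell to the rim, above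
the last cell of its first row. -/
def repeatRow (mu : YoungDiagram) : YoungDiagram :=
  ofRowLen (fun i => mu.rowLen (i - 1))
    (fun _ _ h => mu.rowLen_anti _ _ (Nat.sub_le_sub_right h 1))
    ⟨mu.colLen 0 + 1, rowLen_eq_zero_iff.2 le_rfl⟩

/-- The diagram `mu` with one more cell in its first row, which is also one more cell of the rim. -/
def growRow (mu : YoungDiagram) : YoungDiagram :=
  addCell mu 0 fun _ h => absurd h (Nat.succ_ne_zero _)

variable {mu nu : YoungDiagram} {i m : ℕ}

theorem rowLen_repeatRow_zero : (repeatRow mu).rowLen 0 = mu.rowLen 0 :=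
  congrFun (rowLen_ofRowLen _ _) 0

theorem rowLen_repeatRow_succ : (repeatRow mu).rowLen (i + 1) = mu.rowLen i :=
  congrFun (rowLen_ofRowLen _ _) (i + 1)

theorem rowLen_growRow_zero : (growRow mu).rowLen 0 = mu.rowLen 0 + 1 :=
  (congrFun (rowLen_addCell _) 0).trans (Function.update_self ..)

theorem rowLen_growRow_succ : (growRow mu).rowLen (i + 1) = mu.rowLen (i + 1) :=
  (congrFun (rowLen_addCell _) (i + 1)).trans (Function.update_of_ne (Nat.succ_ne_zero i) ..)

theorem colLen_zero_repeatRow (h : mu ≠ ⊥) : (repeatRow mu).colLen 0 = mu.colLen 0 + 1 :=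
  eq_of_forall_lt_iff fun i => by
    rcases i with _ | i <;>
      simp [lt_colLen_iff_lt_rowLen, rowLen_repeatRow_zero, rowLen_repeatRow_succ,
        rowLen_zero_pos_iff, h]

theorem colLen_zero_growRow : (growRow mu).colLen 0 = max 1 (mu.colLen 0) :=
  eq_of_forall_lt_iff fun i => by
    rcases i with _ | i <;>
      simp [lt_colLen_iff_lt_rowLen, rowLen_growRow_zero, rowLen_growRow_succ]

theorem repeatRow_ne_bot (h : mu ≠ ⊥) : repeatRow mu ≠ ⊥ :=
  colLen_zero_pos_iff.1 (by rw [colLen_zero_repeatRow h]; exact Nat.succ_pos _)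

theorem growRow_ne_bot : growRow mu ≠ ⊥ :=
  rowLen_zero_pos_iff.1 (by rw [rowLen_growRow_zero]; exact Nat.succ_pos _)

theorem repeatRow_injective : Function.Injective repeatRow := fun mu nu h =>
  rowLen_injective <| funext fun i => by
    simpa only [rowLen_repeatRow_succ] using congrArg (YoungDiagram.rowLen · (i + 1)) h

theorem growRow_injective : Function.Injective growRow := fun mu nu h =>
  rowLen_injective <| funext fun i => by
    rcases i with _ | i
    · simpa [rowLen_growRow_zero] using congrArg (YoungDiagram.rowLen · 0) h
    · simpa only [rowLen_growRow_succ] using congrArg (YoungDiagram.rowLen · (i + 1)) h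

theorem growRow_ne_repeatRow : growRow mu ≠ repeatRow nu := fun h => by
  have hfirst := congrArg (YoungDiagram.rowLen · 0) h
  have hsecond := congrArg (YoungDiagram.rowLen · (0 + 1)) h
  simp only [rowLen_growRow_zero, rowLen_growRow_succ, rowLen_repeatRow_zero,
    rowLen_repeatRow_succ] at hfirst hsecond
  have := mu.rowLen_anti 0 (0 + 1) (Nat.zero_le _)
  omega

theorem exists_repeatRow_eq (h : mu.rowLen 1 = mu.rowLen 0) : ∃ nu, repeatRow nu = mu := by
  have hanti : Antitone fun i => mu.rowLen (i + 1) :=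
    fun _ _ h => mu.rowLen_anti _ _ (Nat.succ_le_succ h)
  have hzero : mu.rowLen (mu.colLen 0 + 1) = 0 := rowLen_eq_zero_iff.2 (Nat.le_succ _)
  refine ⟨ofRowLen _ hanti ⟨_, hzero⟩, rowLen_injective (funext fun i => ?_)⟩
  rcases i with _ | i
  · rw [rowLen_repeatRow_zero, rowLen_ofRowLen, zero_add, h]
  · rw [rowLen_repeatRow_succ, rowLen_ofRowLen]

theorem exists_growRow_eq (h : mu.rowLen 1 < mu.rowLen 0) : ∃ nu, growRow nu = mu := by
  have hanti : Antitone (Function.update mu.rowLen 0 (mu.rowLen 0 - 1)) :=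
    antitone_nat_of_succ_le fun i => by
      rcases i with _ | i
      · simpa using Nat.le_sub_one_of_lt h
      · simpa using mu.rowLen_anti _ _ (Nat.le_succ _)
  have hzero : Function.update mu.rowLen 0 (mu.rowLen 0 - 1) (mu.colLen 0 + 1) = 0 := by
    rw [Function.update_of_ne (Nat.succ_ne_zero _), rowLen_eq_zero_iff.2 (Nat.le_succ _)]
  refine ⟨ofRowLen _ hanti ⟨_, hzero⟩, rowLen_injective (funext fun i => ?_)⟩
  rcases i with _ | i
  · rw [rowLen_growRow_zero, rowLen_ofRowLen, Function.update_self]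
    omega
  · rw [rowLen_growRow_succ, rowLen_ofRowLen, Function.update_of_ne (Nat.succ_ne_zero i)]

theorem eq_growRow_or_eq_repeatRow (h : mu ≠ ⊥) :
    (∃ nu, growRow nu = mu) ∨ ∃ nu ≠ ⊥, repeatRow nu = mu := by
  rcases (mu.rowLen_anti 0 1 zero_le_one).lt_or_eq with hrow | hrow
  · exact .inl (exists_growRow_eq hrow)
  · obtain ⟨nu, rfl⟩ := exists_repeatRow_eq hrow
    refine .inr ⟨nu, ?_, rfl⟩
    rwa [← rowLen_zero_pos_iff, rowLen_repeatRow_zero, rowLen_zero_pos_iff] at h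

theorem size_rimShape_bot : (rimShape ⊥).size = 0 :=
  Nat.eq_zero_of_add_eq_zero_right (SkewShape.size_add_card_inner (R := rimShape ⊥))

theorem size_rimShape_pos (h : mu ≠ ⊥) : 0 < (rimShape mu).size := by
  have := size_rimShape_add_one h
  have := rowLen_zero_pos_iff.2 h
  have := colLen_zero_pos_iff.2 h
  omega

theorem size_rimShape_repeatRow (h : mu ≠ ⊥) :
    (rimShape (repeatRow mu)).size = (rimShape mu).size + 1 := by
  have hsize := size_rimShape_add_one (repeatRow_ne_bot h)
  rw [rowLen_repeatRow_zero, colLen_zero_repeatRow h] at hsize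
  have := size_rimShape_add_one h
  omega

theorem size_rimShape_growRow : (rimShape (growRow mu)).size = (rimShape mu).size + 1 := by
  have hsize := size_rimShape_add_one (growRow_ne_bot (mu := mu))
  rw [rowLen_growRow_zero, colLen_zero_growRow] at hsize
  rcases eq_or_ne mu ⊥ with rfl | h
  · rw [rowLen_bot, colLen_zero_bot] at hsize
    rw [size_rimShape_bot]
    exact Nat.succ_injective hsize
  · have := size_rimShape_add_one h
    have := colLen_zero_pos_iff.2 h
    omega

theorem ribbons_zero : ribbons 0 = {rimShape ⊥} := by
  ext R
  rw [mem_ribbons, Finset.mem_singleton]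
  constructor
  · rintro ⟨mu, hmu, rfl⟩
    rw [not_ne_iff.1 fun h => (size_rimShape_pos h).ne' hmu]
  · rintro rfl
    exact ⟨⊥, size_rimShape_bot, rfl⟩

open Classical in
theorem ribbons_succ :
    ribbons (m + 1) = (ribbons m).image (fun R => rimShape (growRow R.outer)) ∪
      {R ∈ ribbons m | R.outer ≠ ⊥}.image fun R => rimShape (repeatRow R.outer) := by
  ext S
  simp only [Finset.mem_union, Finset.mem_image, Finset.mem_filter]
  constructor
  · intro hS
    obtain ⟨mu, hmu, rfl⟩ := mem_ribbons.1 hS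
    have hbot : mu ≠ ⊥ := by
      rintro rfl
      exact absurd (size_rimShape_bot.symm.trans hmu) (Nat.succ_ne_zero m).symm
    rcases eq_growRow_or_eq_repeatRow hbot with ⟨nu, rfl⟩ | ⟨nu, hnu, rfl⟩
    · rw [size_rimShape_growRow, Nat.add_right_cancel_iff] at hmu
      exact .inl ⟨rimShape nu, rimShape_mem_ribbons.2 hmu, rfl⟩
    · rw [size_rimShape_repeatRow hnu, Nat.add_right_cancel_iff] at hmu
      exact .inr ⟨rimShape nu, ⟨rimShape_mem_ribbons.2 hmu, hnu⟩, rfl⟩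
  · rintro (⟨R, hR, rfl⟩ | ⟨R, ⟨hR, hbot⟩, rfl⟩) <;> obtain ⟨mu, rfl, rfl⟩ := mem_ribbons.1 hR
    · exact rimShape_mem_ribbons.2 size_rimShape_growRow
    · exact rimShape_mem_ribbons.2 (size_rimShape_repeatRow hbot)

theorem outer_injOn_ribbons : Set.InjOn SkewShape.outer (ribbons m : Set SkewShape) := by
  intro R hR S hS h
  obtain ⟨mu, -, rfl⟩ := mem_ribbons.1 hR
  obtain ⟨nu, -, rfl⟩ := mem_ribbons.1 hS
  exact congrArg rimShape h

open Classical in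
theorem sum_ribbons_succ {M : Type*} [AddCommMonoid M] (f : SkewShape → M) :
    ∑ R ∈ ribbons (m + 1), f R =
      ∑ R ∈ ribbons m, f (rimShape (growRow R.outer)) +
        ∑ R ∈ ribbons m with R.outer ≠ ⊥, f (rimShape (repeatRow R.outer)) := by
  rw [ribbons_succ, Finset.sum_union, Finset.sum_image, Finset.sum_image]
  · exact fun R hR S hS h => outer_injOn_ribbons (Finset.filter_subset _ _ hR)
      (Finset.filter_subset _ _ hS) (repeatRow_injective (congrArg SkewShape.outer h))
  · exact fun R hR S hS h => outer_injOn_ribbons hR hS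
      (growRow_injective (congrArg SkewShape.outer h))
  · rw [Finset.disjoint_left]
    intro S hS hS'
    obtain ⟨R, -, rfl⟩ := Finset.mem_image.1 hS
    obtain ⟨R', -, h⟩ := Finset.mem_image.1 hS'
    exact growRow_ne_repeatRow (congrArg SkewShape.outer h).symm

end Growth

/-! ### Ribbon determinants -/

section RibbonDeterminants

variable {A : Type*} [CommRing A] {g : ℤ → A} {mu : YoungDiagram} {i : ℕ}

/-- The row lengths shifted by their index, `λ_i - i`: the Jacobi--Trudi matrix depends on the
outer and the inner diagram through these only. -/
def shiftedRowLen (mu : YoungDiagram) (i : ℕ) : ℤ := mu.rowLen i - i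

/-- The Jacobi--Trudi determinant of a skew shape, with an arbitrary sequence `g` in place of the
elementary symmetric functions. -/
def skewDet (g : ℤ → A) (R : SkewShape) : A :=
  jtDet g (R.outer.colLen 0) (shiftedRowLen R.outer) (shiftedRowLen R.inner)

theorem skewDet_rimShape (g : ℤ → A) (mu : YoungDiagram) :
    skewDet g (rimShape mu) =
      jtDet g (mu.colLen 0) (shiftedRowLen mu) (shiftedRowLen (removeFirstHook mu)) :=
  rfl

theorem skewDet_rimShape_bot : skewDet g (rimShape ⊥) = 1 := by
  rw [skewDet_rimShape, colLen_zero_bot, jtDet_zero]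

theorem removeFirstHook_growRow : removeFirstHook (growRow mu) = removeFirstHook mu :=
  rowLen_injective <| funext fun i => by
    rw [rowLen_removeFirstHook, rowLen_removeFirstHook, rowLen_growRow_succ]

theorem skewDet_rimShape_growRow_bot : skewDet g (rimShape (growRow ⊥)) = g 1 := by
  rw [skewDet_rimShape, colLen_zero_growRow, colLen_zero_bot, max_eq_left zero_le_one, ← zero_add 1,
    jtDet_succ_of_last_row_eq_zero (by simp), jtDet_zero, mul_one]
  simp [shiftedRowLen, rowLen_growRow_zero, removeFirstHook_growRow, rowLen_removeFirstHook,
    rowLen_bot]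

theorem shiftedRowLen_zero : shiftedRowLen mu 0 = mu.rowLen 0 :=
  sub_zero _

theorem shiftedRowLen_repeatRow_succ :
    shiftedRowLen (repeatRow mu) (i + 1) = shiftedRowLen mu i - 1 := by
  simp only [shiftedRowLen, rowLen_repeatRow_succ]
  omega

theorem shiftedRowLen_growRow :
    shiftedRowLen (growRow mu) = Function.update (shiftedRowLen mu) 0 (mu.rowLen 0 + 1) := by
  ext i
  rcases i with _ | i
  · simp [shiftedRowLen, rowLen_growRow_zero]
  · simp [shiftedRowLen, rowLen_growRow_succ]

theorem shiftedRowLen_removeFirstHook_repeatRow_zero (h : mu ≠ ⊥) :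
    shiftedRowLen (removeFirstHook (repeatRow mu)) 0 = mu.rowLen 0 - 1 := by
  have := rowLen_zero_pos_iff.2 h
  simp only [shiftedRowLen, rowLen_removeFirstHook, rowLen_repeatRow_succ]
  omega

theorem shiftedRowLen_removeFirstHook_repeatRow_succ :
    shiftedRowLen (removeFirstHook (repeatRow mu)) (i + 1) =
      shiftedRowLen (removeFirstHook mu) i - 1 := by
  simp only [shiftedRowLen, rowLen_removeFirstHook, rowLen_repeatRow_succ]
  omega

/-- Expansion along the first column, whose entries are `g 1`, `g 0` and zeros. -/
theorem skewDet_rimShape_repeatRow (hneg : ∀ d < 0, g d = 0) (hzero : g 0 = 1) (h : mu ≠ ⊥) :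
    skewDet g (rimShape (repeatRow mu)) =
      g 1 * skewDet g (rimShape mu) - skewDet g (rimShape (growRow mu)) := by
  obtain ⟨n, hn⟩ := Nat.exists_eq_succ_of_ne_zero (colLen_zero_pos_iff.2 h).ne'
  have hlower (i : ℕ) : shiftedRowLen mu (i + 1) < mu.rowLen 0 := by
    have := mu.rowLen_anti 0 (i + 1) (Nat.zero_le _)
    simp only [shiftedRowLen]
    omega
  have hsecond : shiftedRowLen (repeatRow mu) 1 = mu.rowLen 0 - 1 := by
    rw [← zero_add 1, shiftedRowLen_repeatRow_succ, shiftedRowLen_zero]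
  rw [skewDet_rimShape, skewDet_rimShape, skewDet_rimShape, colLen_zero_repeatRow h,
    colLen_zero_growRow, hn, max_eq_right (Nat.le_add_left 1 n), removeFirstHook_growRow,
    shiftedRowLen_growRow, jtDet_succ_succ_of_first_col_eq_zero]
  · simp only [hsecond, shiftedRowLen_repeatRow_succ, shiftedRowLen_zero,
      rowLen_repeatRow_zero, shiftedRowLen_removeFirstHook_repeatRow_succ,
      shiftedRowLen_removeFirstHook_repeatRow_zero h]
    rw [sub_sub_cancel, sub_self, hzero, one_mul]
    congr 1
    · congr 1
      exact jtDet_congr fun i _ j _ => sub_sub_sub_cancel_right ..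
    · refine jtDet_congr fun i _ j _ => ?_
      rcases i with _ | i
      · simp only [Function.update_self]
        ring
      · simp only [Function.update_of_ne (Nat.succ_ne_zero i)]
        ring
  · intro i _
    rw [shiftedRowLen_repeatRow_succ, shiftedRowLen_removeFirstHook_repeatRow_zero h]
    exact hneg _ (by have := hlower i; omega)

theorem sum_skewDet_ribbons (hneg : ∀ d < 0, g d = 0) (hzero : g 0 = 1) (m : ℕ) :
    ∑ R ∈ ribbons m, skewDet g R = g 1 ^ m := by
  classical
  induction m with
  | zero => rw [ribbons_zero, Finset.sum_singleton, skewDet_rimShape_bot, pow_zero]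
  | succ m ih =>
    rw [sum_ribbons_succ, Finset.sum_filter, ← Finset.sum_add_distrib, pow_succ', ← ih,
      Finset.mul_sum]
    refine Finset.sum_congr rfl fun R hR => ?_
    obtain ⟨mu, -, rfl⟩ := mem_ribbons.1 hR
    change skewDet g (rimShape (growRow mu)) +
      (if mu ≠ ⊥ then skewDet g (rimShape (repeatRow mu)) else 0) = _
    split_ifs with h
    · rw [skewDet_rimShape_repeatRow hneg hzero h, add_sub_cancel]
    · rw [not_ne_iff.1 h, skewDet_rimShape_growRow_bot, skewDet_rimShape_bot, add_zero, mul_one]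

end RibbonDeterminants

/-! ### Straight shapes and the Pieri rule for one cell -/

section Pieri

variable {mu lam : YoungDiagram} {i m : ℕ}

theorem mem_partitionsOf : mu ∈ partitionsOf m ↔ mu.card = m := by
  simp [partitionsOf]

theorem partitionsOf_zero : partitionsOf 0 = {⊥} := by
  ext mu
  rw [mem_partitionsOf, Finset.mem_singleton, YoungDiagram.card, Finset.card_eq_zero,
    ← YoungDiagram.cells_bot, YoungDiagram.ext_iff]

theorem card_transpose : mu.transpose.card = mu.card :=
  Finset.card_map _

theorem exists_cells_eq_insert (hle : mu ≤ lam) (hcard : lam.card = mu.card + 1) :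
    ∃ c ∉ mu.cells, lam.cells = insert c mu.cells :=
  (Finset.covBy_iff_exists_insert.1 (Finset.covBy_iff_card_sdiff_eq_one.2
    ⟨YoungDiagram.cells_subset_iff.2 hle, by
      rw [Finset.card_sdiff_of_subset (YoungDiagram.cells_subset_iff.2 hle)]
      exact Nat.sub_eq_of_eq_add' hcard⟩)).imp fun _ h => ⟨h.1, h.2.symm⟩

theorem exists_rowLen_eq_update (hle : mu ≤ lam) (hcard : lam.card = mu.card + 1) :
    ∃ i, lam.rowLen = Function.update mu.rowLen i (mu.rowLen i + 1) := by
  obtain ⟨⟨p, q⟩, hnew, hinsert⟩ := exists_cells_eq_insert hle hcard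
  have lt_rowLen_iff (i j : ℕ) : j < lam.rowLen i ↔ i = p ∧ j = q ∨ j < mu.rowLen i := by
    rw [← YoungDiagram.mem_iff_lt_rowLen, ← YoungDiagram.mem_cells, hinsert, Finset.mem_insert,
      Prod.mk.injEq, YoungDiagram.mem_cells, YoungDiagram.mem_iff_lt_rowLen]
  rw [YoungDiagram.mem_cells, YoungDiagram.mem_iff_lt_rowLen, not_lt] at hnew
  have hq : q = mu.rowLen p := by
    have := lt_rowLen_iff p q
    have := lt_rowLen_iff p (mu.rowLen p)
    omega
  refine ⟨p, funext fun i => eq_of_forall_lt_iff fun j => ?_⟩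
  rw [lt_rowLen_iff, Function.update_apply]
  split_ifs with h
  · subst h
    omega
  · simp [h]

theorem cells_eq_insert_of_rowLen_eq_update
    (h : lam.rowLen = Function.update mu.rowLen i (mu.rowLen i + 1)) :
    lam.cells = insert (i, mu.rowLen i) mu.cells := by
  ext ⟨r, c⟩
  rw [Finset.mem_insert, YoungDiagram.mem_cells, YoungDiagram.mem_cells,
    YoungDiagram.mem_iff_lt_rowLen, YoungDiagram.mem_iff_lt_rowLen, h, Function.update_apply,
    Prod.mk.injEq]
  split_ifs with hr
  · subst hr
    omega
  · simp [hr]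

theorem le_of_rowLen_eq_update
    (h : lam.rowLen = Function.update mu.rowLen i (mu.rowLen i + 1)) : mu ≤ lam :=
  YoungDiagram.cells_subset_iff.1 <|
    cells_eq_insert_of_rowLen_eq_update h ▸ Finset.subset_insert _ _

theorem card_of_rowLen_eq_update
    (h : lam.rowLen = Function.update mu.rowLen i (mu.rowLen i + 1)) :
    lam.card = mu.card + 1 := by
  rw [YoungDiagram.card, cells_eq_insert_of_rowLen_eq_update h, Finset.card_insert_of_notMem]
  rw [YoungDiagram.mem_cells, YoungDiagram.mem_iff_lt_rowLen]
  exact lt_irrefl _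

theorem le_colLen_zero_of_rowLen_eq_update
    (h : lam.rowLen = Function.update mu.rowLen i (mu.rowLen i + 1)) : i ≤ mu.colLen 0 := by
  by_contra! hi
  have hanti := lam.rowLen_anti _ _ hi.le
  rw [h, Function.update_self, Function.update_of_ne hi.ne, rowLen_eq_zero_iff.2 le_rfl] at hanti
  omega

theorem colLen_zero_le_of_rowLen_eq_update
    (h : lam.rowLen = Function.update mu.rowLen i (mu.rowLen i + 1)) :
    lam.colLen 0 ≤ mu.colLen 0 + 1 := by
  have := le_colLen_zero_of_rowLen_eq_update h
  rw [← rowLen_eq_zero_iff, h, Function.update_of_ne (by omega),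
    rowLen_eq_zero_iff.2 (Nat.le_succ _)]

theorem shiftedRowLen_eq_update
    (h : lam.rowLen = Function.update mu.rowLen i (mu.rowLen i + 1)) :
    shiftedRowLen lam = Function.update (shiftedRowLen mu) i (shiftedRowLen mu i + 1) := by
  ext r
  simp only [shiftedRowLen, h, Function.update_apply]
  split_ifs with hr
  · subst hr
    push_cast
    ring
  · rfl

/-- A Young diagram as a skew shape. -/
def SkewShape.straight (mu : YoungDiagram) : SkewShape := ⟨mu, ⊥, bot_le⟩

variable {A : Type*} [CommRing A] {g : ℤ → A}

theorem skewDet_straight_eq_jtDet (hneg : ∀ d < 0, g d = 0) (hzero : g 0 = 1) {n : ℕ}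
    (hn : mu.colLen 0 ≤ n) :
    skewDet g (SkewShape.straight mu) = jtDet g n (shiftedRowLen mu) fun j => -j := by
  induction n, hn using Nat.le_induction with
  | base =>
    refine jtDet_congr fun i _ j _ => ?_
    simp [SkewShape.straight, shiftedRowLen, rowLen_bot]
  | succ n hn ih =>
    rw [ih, jtDet_succ_of_eq_neg hneg hzero]
    simp [shiftedRowLen, rowLen_eq_zero_iff.2 hn]

theorem jtDet_raise_row_eq_zero {n : ℕ} {b : ℕ → ℤ} (hi : i < n) {j : ℕ} (hj : j + 1 = i)
    (h : mu.rowLen j ≤ mu.rowLen i) :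
    jtDet g n (Function.update (shiftedRowLen mu) i (shiftedRowLen mu i + 1)) b = 0 := by
  have := mu.rowLen_anti j i (by omega)
  refine jtDet_eq_zero_of_row_eq hi (j := j) (by omega) (by omega) ?_
  rw [Function.update_self, Function.update_of_ne (by omega)]
  simp only [shiftedRowLen]
  omega

open Classical in
theorem sum_skewDet_straight_of_le (hneg : ∀ d < 0, g d = 0) (hzero : g 0 = 1)
    (mu : YoungDiagram) :
    ∑ lam ∈ partitionsOf (mu.card + 1) with mu ≤ lam, skewDet g (SkewShape.straight lam) =
      g 1 * skewDet g (SkewShape.straight mu) := by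
  have hrow (lam) (hlam : lam ∈ {lam ∈ partitionsOf (mu.card + 1) | mu ≤ lam}) :
      ∃ i, lam.rowLen = Function.update mu.rowLen i (mu.rowLen i + 1) := by
    rw [Finset.mem_filter, mem_partitionsOf] at hlam
    exact exists_rowLen_eq_update hlam.2 hlam.1
  choose! row hrow using hrow
  rw [skewDet_straight_eq_jtDet hneg hzero le_rfl, mul_jtDet_eq_sum_raise_row hneg
    (by simp [shiftedRowLen, rowLen_eq_zero_iff.2])]
  refine Finset.sum_of_injOn row ?_ ?_ ?_ ?_
  · exact fun lam hlam nu hnu h => rowLen_injective (by rw [hrow lam hlam, hrow nu hnu, h])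
  · exact fun lam hlam => by
      simpa [Nat.lt_succ_iff] using le_colLen_zero_of_rowLen_eq_update (hrow lam hlam)
  · intro i hi hnot
    have not_addable : ¬ ∀ j, j + 1 = i → mu.rowLen i < mu.rowLen j := fun hadd => by
      have hadd := rowLen_addCell hadd
      have hmem := Finset.mem_filter.2 ⟨mem_partitionsOf.2 (card_of_rowLen_eq_update hadd),
        le_of_rowLen_eq_update hadd⟩
      refine hnot ⟨_, hmem, ?_⟩
      by_contra hne
      have := congrFun (hadd.symm.trans (hrow _ hmem)) i
      simp [Function.update_of_ne (Ne.symm hne)] at this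
    push Not at not_addable
    obtain ⟨j, hj, hle⟩ := not_addable
    exact jtDet_raise_row_eq_zero (Finset.mem_range.1 hi) hj hle
  · intro lam hlam
    rw [skewDet_straight_eq_jtDet hneg hzero (colLen_zero_le_of_rowLen_eq_update (hrow lam hlam)),
      shiftedRowLen_eq_update (hrow lam hlam)]

open Classical in
theorem sum_skewDet_straight_transpose_of_le (hneg : ∀ d < 0, g d = 0) (hzero : g 0 = 1)
    (mu : YoungDiagram) :
    ∑ lam ∈ partitionsOf (mu.card + 1) with mu ≤ lam,
        skewDet g (SkewShape.straight lam.transpose) =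
      g 1 * skewDet g (SkewShape.straight mu.transpose) := by
  rw [← sum_skewDet_straight_of_le hneg hzero]
  refine Finset.sum_equiv YoungDiagram.transposeOrderIso.toEquiv (fun lam => ?_) fun _ _ => rfl
  simp [mem_partitionsOf, YoungDiagram.transpose_le_iff, card_transpose,
    YoungDiagram.transposeOrderIso]

end Pieri

/-! ### The branching rule for standard Young tableaux -/

section Branching

variable {mu lam : YoungDiagram} {m N : ℕ} {T : SemistandardYoungTableau mu}
  {S : SemistandardYoungTableau lam}

/-- The skew shape `lam / mu` has at most one cell in each column. -/
def IsHorizontalStrip (mu lam : YoungDiagram) : Prop :=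
  ∀ ⦃i i' j⦄, i < i' → (i', j) ∈ lam → (i, j) ∈ mu

theorem isHorizontalStrip_of_card_eq_succ (hle : mu ≤ lam) (hcard : lam.card = mu.card + 1) :
    IsHorizontalStrip mu lam := by
  obtain ⟨c, -, hinsert⟩ := exists_cells_eq_insert hle hcard
  have eq_of_notMem {d : ℕ × ℕ} (hd : d ∈ lam) (hd' : d ∉ mu) : d = c := by
    rw [← YoungDiagram.mem_cells, hinsert, Finset.mem_insert] at hd
    exact hd.resolve_right hd'
  intro i i' j hi h
  by_contra hmu
  have hupper := eq_of_notMem (lam.up_left_mem hi.le le_rfl h) hmu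
  have hlower := eq_of_notMem h fun h' => hmu (mu.up_left_mem hi.le le_rfl h')
  exact hi.ne (congrArg Prod.fst (hupper.trans hlower.symm))

/-- Extend a tableau of shape `mu` by the constant `N`, which exceeds its entries, on the
horizontal strip `lam / mu`. -/
def extendTableau (hstrip : IsHorizontalStrip mu lam) (T : SemistandardYoungTableau mu)
    (hT : ∀ c ∈ mu, T c.1 c.2 < N) : SemistandardYoungTableau lam where
  entry i j := if (i, j) ∈ lam then if (i, j) ∈ mu then T i j else N else 0
  row_weak' {i j j'} hj h := by
    rw [if_pos h, if_pos (lam.up_left_mem le_rfl hj.le h)]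
    split_ifs with hleft hright hright
    · exact T.row_weak hj hright
    · exact (hT _ hleft).le
    · exact absurd (mu.up_left_mem le_rfl hj.le hright) hleft
    · exact le_rfl
  col_strict' {i i' j} hi h := by
    have hmu := hstrip hi h
    rw [if_pos h, if_pos (lam.up_left_mem hi.le le_rfl h), if_pos hmu]
    split_ifs with hlow
    · exact T.col_strict hi hlow
    · exact hT _ hmu
  zeros' h := if_neg h

/-- The restriction of a tableau to a smaller shape. -/
def restrictTableau (hle : mu ≤ lam) (S : SemistandardYoungTableau lam) :
    SemistandardYoungTableau mu where
  entry i j := if (i, j) ∈ mu then S i j else 0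
  row_weak' hj h := by
    rw [if_pos h, if_pos (mu.up_left_mem le_rfl hj.le h)]
    exact S.row_weak hj (hle h)
  col_strict' hi h := by
    rw [if_pos h, if_pos (mu.up_left_mem hi.le le_rfl h)]
    exact S.col_strict hi (hle h)
  zeros' h := if_neg h

/-- The diagram of the cells of a tableau whose entries are at most `m`. -/
def sublevelDiagram (S : SemistandardYoungTableau lam) (m : ℕ) : YoungDiagram where
  cells := lam.cells.filter fun c => S c.1 c.2 ≤ m
  isLowerSet := by
    rintro ⟨i, j⟩ ⟨i', j'⟩ ⟨hi, hj⟩ h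
    simp only [Finset.coe_filter, Set.mem_ofPred_eq, YoungDiagram.mem_cells] at h ⊢
    exact ⟨lam.up_left_mem hi hj h.1, (S.col_weak hi (lam.up_left_mem le_rfl hj h.1)).trans
      ((S.row_weak_of_le hj h.1).trans h.2)⟩

theorem mem_sublevelDiagram {c : ℕ × ℕ} :
    c ∈ sublevelDiagram S m ↔ c ∈ lam ∧ S c.1 c.2 ≤ m := by
  rw [← YoungDiagram.mem_cells, sublevelDiagram, Finset.mem_filter, YoungDiagram.mem_cells]

theorem sublevelDiagram_le : sublevelDiagram S m ≤ lam :=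
  fun _ h => (mem_sublevelDiagram.1 h).1

theorem extendTableau_apply_of_mem (hstrip : IsHorizontalStrip mu lam)
    (hT : ∀ c ∈ mu, T c.1 c.2 < N) (hle : mu ≤ lam) {c : ℕ × ℕ} (hc : c ∈ mu) :
    extendTableau hstrip T hT c.1 c.2 = T c.1 c.2 :=
  (if_pos (hle hc)).trans (if_pos hc)

theorem extendTableau_apply_of_notMem (hstrip : IsHorizontalStrip mu lam)
    (hT : ∀ c ∈ mu, T c.1 c.2 < N) {c : ℕ × ℕ} (hc : c ∈ lam) (hc' : c ∉ mu) :
    extendTableau hstrip T hT c.1 c.2 = N :=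
  (if_pos hc).trans (if_neg hc')

theorem restrictTableau_apply_of_mem {hle : mu ≤ lam} {c : ℕ × ℕ} (hc : c ∈ mu) :
    restrictTableau hle S c.1 c.2 = S c.1 c.2 :=
  if_pos hc

theorem sublevelDiagram_extendTableau (hstrip : IsHorizontalStrip mu lam)
    (hT : ∀ c ∈ mu, T c.1 c.2 < m + 1) (hle : mu ≤ lam) :
    sublevelDiagram (extendTableau hstrip T hT) m = mu :=
  SetLike.ext fun c => by
    rw [mem_sublevelDiagram]
    by_cases hc : c ∈ mu
    · rw [extendTableau_apply_of_mem hstrip hT hle hc]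
      simp [hc, hle hc, Nat.lt_succ_iff.1 (hT c hc)]
    · simp +contextual [hc, extendTableau_apply_of_notMem]

theorem restrictTableau_extendTableau (hstrip : IsHorizontalStrip mu lam)
    (hT : ∀ c ∈ mu, T c.1 c.2 < N) (hle : mu ≤ lam) :
    restrictTableau hle (extendTableau hstrip T hT) = T :=
  SemistandardYoungTableau.ext fun i j => by
    by_cases h : (i, j) ∈ mu
    · exact (restrictTableau_apply_of_mem h).trans (extendTableau_apply_of_mem hstrip hT hle h)
    · rw [SemistandardYoungTableau.zeros _ h, T.zeros h]

theorem extendTableau_restrictTableau (hstrip : IsHorizontalStrip mu lam) (hle : mu ≤ lam)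
    (hS : ∀ c ∈ mu, restrictTableau hle S c.1 c.2 < N)
    (hnew : ∀ c ∈ lam, c ∉ mu → S c.1 c.2 = N) :
    extendTableau hstrip (restrictTableau hle S) hS = S :=
  SemistandardYoungTableau.ext fun i j => by
    by_cases hlam : (i, j) ∈ lam
    · by_cases hmu : (i, j) ∈ mu
      · exact (extendTableau_apply_of_mem hstrip hS hle hmu).trans
          (restrictTableau_apply_of_mem hmu)
      · exact (extendTableau_apply_of_notMem hstrip hS hlam hmu).trans (hnew _ hlam hmu).symm
    · rw [SemistandardYoungTableau.zeros _ hlam, S.zeros hlam]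

theorem IsStandard.lt_card_add_one (hT : IsStandard T) (c : ℕ × ℕ) (hc : c ∈ mu) :
    T c.1 c.2 < mu.card + 1 :=
  Nat.lt_succ_of_le (hT.mapsTo hc).2

theorem finite_isStandard (mu : YoungDiagram) :
    Finite {T : SemistandardYoungTableau mu // IsStandard T} := by
  refine Finite.of_injective (β := mu.cells → Fin (mu.card + 1))
    (fun T c => ⟨_, T.2.lt_card_add_one c c.2⟩) fun T T' h => ?_
  refine Subtype.ext (SemistandardYoungTableau.ext fun i j => ?_)
  by_cases hc : (i, j) ∈ mu
  · exact congrArg Fin.val (congrFun h ⟨(i, j), hc⟩)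
  · rw [T.1.zeros hc, T'.1.zeros hc]

theorem IsStandard.bijOn_sublevelDiagram (hS : IsStandard S) (hm : m ≤ lam.card) :
    Set.BijOn (fun c : ℕ × ℕ => S c.1 c.2) (sublevelDiagram S m).cells (Set.Icc 1 m) := by
  convert! Set.BijOn.subset_right hS (Set.Icc_subset_Icc_right hm) using 1
  ext c
  simp only [Finset.mem_coe, YoungDiagram.mem_cells, mem_sublevelDiagram, Set.mem_inter_iff,
    Set.mem_preimage, Set.mem_Icc, and_congr_right_iff]
  exact fun hc => ⟨fun h => ⟨(hS.mapsTo hc).1, h⟩, And.right⟩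

theorem IsStandard.card_sublevelDiagram (hS : IsStandard S) (hm : m ≤ lam.card) :
    (sublevelDiagram S m).card = m := by
  have hbij := hS.bijOn_sublevelDiagram hm
  have hncard := hbij.injOn.ncard_image
  rwa [hbij.image_eq, Set.ncard_coe_finset, ← Finset.coe_Icc, Set.ncard_coe_finset, Nat.card_Icc,
    Nat.add_sub_cancel, eq_comm] at hncard

theorem IsStandard.restrictTableau (hS : IsStandard S) (hle : mu ≤ lam)
    (h : sublevelDiagram S mu.card = mu) : IsStandard (restrictTableau hle S) := by
  have hbij := hS.bijOn_sublevelDiagram (Finset.card_le_card (YoungDiagram.cells_subset_iff.2 hle))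
  rw [h] at hbij
  exact hbij.congr fun c hc => (restrictTableau_apply_of_mem hc).symm

theorem IsStandard.extendTableau (hT : IsStandard T) (hle : mu ≤ lam)
    (hcard : lam.card = mu.card + 1) :
    IsStandard (extendTableau (isHorizontalStrip_of_card_eq_succ hle hcard) T
      hT.lt_card_add_one) := by
  have hstrip := isHorizontalStrip_of_card_eq_succ hle hcard
  obtain ⟨c, hc, hinsert⟩ := exists_cells_eq_insert hle hcard
  have hlam : c ∈ lam := by
    rw [← YoungDiagram.mem_cells, hinsert]
    exact Finset.mem_insert_self _ _
  have hold := hT.congr fun d hd =>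
    (extendTableau_apply_of_mem hstrip hT.lt_card_add_one hle hd).symm
  have hnew := extendTableau_apply_of_notMem hstrip hT.lt_card_add_one hlam hc
  have hbij := hold.insert (a := c) (by simp only [hnew]; simp)
  simp only [hnew] at hbij
  rw [IsStandard, hinsert, Finset.coe_insert, hcard]
  convert! hbij using 1
  ext x
  simp only [Set.mem_Icc, Set.mem_insert_iff]
  omega

theorem IsStandard.apply_eq_card_of_notMem (hS : IsStandard S) (hcard : lam.card = m + 1)
    {c : ℕ × ℕ} (hc : c ∈ lam) (hc' : c ∉ sublevelDiagram S m) : S c.1 c.2 = m + 1 := by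
  have hle := (hS.mapsTo hc).2
  have hlt : ¬ S c.1 c.2 ≤ m := fun h => hc' (mem_sublevelDiagram.2 ⟨hc, h⟩)
  exact le_antisymm (hcard ▸ hle) (not_le.1 hlt)

theorem card_isStandard_sublevelDiagram_eq (hle : mu ≤ lam) (hcard : lam.card = mu.card + 1) :
    Nat.card {S : {S : SemistandardYoungTableau lam // IsStandard S} //
      sublevelDiagram S.1 mu.card = mu} = numSYT mu := by
  have hstrip := isHorizontalStrip_of_card_eq_succ hle hcard
  exact Nat.card_congr
    { toFun S := ⟨restrictTableau hle S.1.1, S.1.2.restrictTableau hle S.2⟩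
      invFun T := ⟨⟨_, T.2.extendTableau hle hcard⟩,
        sublevelDiagram_extendTableau hstrip T.2.lt_card_add_one hle⟩
      left_inv S := Subtype.ext <| Subtype.ext <| extendTableau_restrictTableau hstrip hle
        (S.1.2.restrictTableau hle S.2).lt_card_add_one fun c hc hc' =>
          S.1.2.apply_eq_card_of_notMem hcard hc (S.2.symm ▸ hc')
      right_inv T := Subtype.ext (restrictTableau_extendTableau hstrip T.2.lt_card_add_one hle) }

open Classical in
theorem numSYT_eq_sum_of_card_eq_succ (hcard : lam.card = m + 1) :
    numSYT lam = ∑ mu ∈ partitionsOf m with mu ≤ lam, numSYT mu := by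
  have hmem {mu : YoungDiagram} :
      mu ∈ {mu ∈ partitionsOf m | mu ≤ lam} ↔ mu.card = m ∧ mu ≤ lam := by
    rw [Finset.mem_filter, mem_partitionsOf]
  have := finite_isStandard lam
  let innerDiagram (S : {S : SemistandardYoungTableau lam // IsStandard S}) :
      {mu // mu ∈ {mu ∈ partitionsOf m | mu ≤ lam}} :=
    ⟨sublevelDiagram S.1 m, hmem.2 ⟨S.2.card_sublevelDiagram (by omega), sublevelDiagram_le⟩⟩
  rw [numSYT, ← Nat.card_congr (Equiv.sigmaFiberEquiv innerDiagram), Nat.card_sigma,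
    ← Finset.sum_coe_sort _ numSYT]
  refine Finset.sum_congr rfl fun ⟨mu, hmu⟩ _ => ?_
  obtain ⟨rfl, hle⟩ := hmem.1 hmu
  rw [← card_isStandard_sublevelDiagram_eq hle hcard]
  exact Nat.card_congr (Equiv.subtypeEquivRight fun S => Subtype.ext_iff)

theorem numSYT_bot : numSYT ⊥ = 1 := by
  refine Nat.card_eq_one_iff_exists.2 ⟨⟨default, ?_⟩, fun T => Subtype.ext
    (SemistandardYoungTableau.ext fun i j => ?_)⟩
  · simp [IsStandard, YoungDiagram.card]
  · simp only [SemistandardYoungTableau.zeros _ (YoungDiagram.notMem_bot _)]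

theorem sum_numSYT_smul_skewDet_straight_transpose {A : Type*} [CommRing A] {g : ℤ → A}
    (hneg : ∀ d < 0, g d = 0) (hzero : g 0 = 1) (m : ℕ) :
    ∑ mu ∈ partitionsOf m, numSYT mu • skewDet g (SkewShape.straight mu.transpose) = g 1 ^ m := by
  classical
  induction m with
  | zero =>
    rw [partitionsOf_zero, Finset.sum_singleton, numSYT_bot, one_smul, pow_zero,
      skewDet_straight_eq_jtDet hneg hzero (n := 0) (by simp [rowLen_bot]), jtDet_zero]
  | succ m ih =>
    calc
      _ = ∑ lam ∈ partitionsOf (m + 1), ∑ mu ∈ partitionsOf m, if mu ≤ lam then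
            numSYT mu • skewDet g (SkewShape.straight lam.transpose) else 0 :=
        Finset.sum_congr rfl fun lam hlam => by
          rw [numSYT_eq_sum_of_card_eq_succ (mem_partitionsOf.1 hlam), Finset.sum_smul,
            Finset.sum_filter]
      _ = ∑ mu ∈ partitionsOf m,
            numSYT mu • (g 1 * skewDet g (SkewShape.straight mu.transpose)) := by
        rw [Finset.sum_comm]
        refine Finset.sum_congr rfl fun mu hmu => ?_
        rw [← sum_skewDet_straight_transpose_of_le hneg hzero, mem_partitionsOf.1 hmu,
          Finset.smul_sum, Finset.sum_filter]
      _ = g 1 ^ (m + 1) := by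
        simp only [← mul_smul_comm, ← Finset.mul_sum, ih, pow_succ']

end Branching

/-! ### Coefficients of squarefree monomials -/

section Coefficients

open Finset MvPowerSeries

variable {k : ℕ}

open Classical in
theorem coeff_elemSymm (d : ℤ) (a : ℕ →₀ ℕ) :
    coeff a (elemSymm d) = if (∀ j, a j ≤ 1) ∧ (a.degree : ℤ) = d then 1 else 0 :=
  rfl

theorem elemSymm_zero : elemSymm 0 = 1 := by
  classical
  ext a
  rw [coeff_one, coeff_elemSymm]
  refine if_congr ⟨fun h => (Finsupp.degree_eq_zero_iff a).1 (mod_cast h.2), ?_⟩ rfl rfl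
  rintro rfl
  simp

theorem elemSymm_of_neg {d : ℤ} (hd : d < 0) : elemSymm d = 0 := by
  ext a
  exact if_neg fun h => by omega

theorem coeff_single_elemSymm_one (j : ℕ) : coeff (Finsupp.single j 1) (elemSymm 1) = 1 :=
  if_pos ⟨fun i => by rw [Finsupp.single_apply]; split_ifs <;> simp, by simp⟩

theorem exists_eq_single_of_coeff_elemSymm_one_ne_zero {a : ℕ →₀ ℕ}
    (h : coeff a (elemSymm 1) ≠ 0) : ∃ j, a = Finsupp.single j 1 := by
  refine (Finsupp.sum_eq_one_iff a).1 ?_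
  by_contra hdeg
  exact h (if_neg fun ha => hdeg (Nat.cast_eq_one.1 ha.2))

theorem coeff_elemSymm_one_mul (n : ℕ →₀ ℕ) (F : MvPowerSeries ℕ ℚ) :
    coeff n (elemSymm 1 * F) = ∑ j ∈ n.support, coeff (n - Finsupp.single j 1) F := by
  classical
  have hle {j : ℕ} (hj : j ∈ n.support) : Finsupp.single j 1 ≤ n :=
    Finsupp.single_le_iff.2 (Nat.one_le_iff_ne_zero.2 (Finsupp.mem_support_iff.1 hj))
  rw [coeff_mul]
  symm
  refine sum_of_injOn (fun j => (Finsupp.single j 1, n - Finsupp.single j 1))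
    (fun j _ j' _ h => Finsupp.single_left_injective one_ne_zero (congrArg Prod.fst h))
    (fun j hj => mem_antidiagonal.2 (add_tsub_cancel_of_le (hle hj))) ?_
    fun j _ => by rw [coeff_single_elemSymm_one, one_mul]
  rintro ⟨a, b⟩ hab hnot
  refine mul_eq_zero_of_left (not_not.1 fun h => hnot ?_) _
  obtain ⟨j, rfl⟩ := exists_eq_single_of_coeff_elemSymm_one_ne_zero h
  obtain rfl := mem_antidiagonal.1 hab
  exact ⟨j, by simp, by simp⟩

theorem coeff_sum_single_elemSymm_one_pow (s : Finset ℕ) :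
    coeff (∑ j ∈ s, Finsupp.single j 1) (elemSymm 1 ^ s.card) = s.card.factorial := by
  classical
  induction hc : s.card generalizing s with
  | zero => simp [card_eq_zero.1 hc]
  | succ c ih =>
    have hsupp : (∑ j ∈ s, Finsupp.single j 1 : ℕ →₀ ℕ).support = s := by
      ext i
      simp [Finsupp.finsetSum_apply, Finsupp.single_apply]
    rw [pow_succ', coeff_elemSymm_one_mul, hsupp, Nat.factorial_succ, Nat.cast_mul, ← hc,
      ← nsmul_eq_mul]
    refine sum_eq_card_nsmul fun j hj => ?_
    rw [← add_sum_erase s _ hj, add_tsub_cancel_left]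
    exact ih _ (by rw [card_erase_of_mem hj, hc, Nat.add_sub_cancel])

theorem coeff_mapDomain_inAlphabet (i : Fin k) (a : ℕ →₀ ℕ) (f : MvPowerSeries ℕ ℚ) :
    coeff (a.mapDomain (Prod.mk i)) (inAlphabet i f) = coeff a f := by
  let e : ℕ ↪ Fin k × ℕ := ⟨Prod.mk i, Prod.mk_right_injective i⟩
  have := coeff_embDomain_rename e f a
  rwa [Finsupp.embDomain_eq_mapDomain] at this

theorem sum_mapDomain_prodMk_apply (a : Fin k → ℕ →₀ ℕ) (i : Fin k) (j : ℕ) :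
    (∑ i, (a i).mapDomain (Prod.mk i)) (i, j) = a i j := by
  rw [Finsupp.finsetSum_apply, sum_eq_single i]
  · exact Finsupp.mapDomain_apply (Prod.mk_right_injective i) _ _
  · rintro i' - hi'
    exact Finsupp.mapDomain_of_notMem_range _ _ (by rintro ⟨_, h⟩; exact hi' (congrArg Prod.fst h))
  · simp

theorem coeff_prod_inAlphabet (a : Fin k → ℕ →₀ ℕ) (f : Fin k → MvPowerSeries ℕ ℚ) :
    coeff (∑ i, (a i).mapDomain (Prod.mk i)) (∏ i, inAlphabet i (f i)) =
      ∏ i, coeff (a i) (f i) := by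
  classical
  rw [coeff_prod, sum_eq_single (Finsupp.equivFunOnFinite.symm fun i =>
    (a i).mapDomain (Prod.mk i))]
  · exact prod_congr rfl fun i _ => coeff_mapDomain_inAlphabet i (a i) (f i)
  · intro l hl hne
    by_contra hprod
    have hrange (i : Fin k) : ∃ b : ℕ →₀ ℕ, b.mapDomain (Prod.mk i) = l i := by
      by_contra hi
      exact hprod (prod_eq_zero (mem_univ i) (coeff_rename_eq_zero _ _ hi))
    choose b hb using hrange
    have hsum : ∑ i, (b i).mapDomain (Prod.mk i) = ∑ i, (a i).mapDomain (Prod.mk i) := by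
      simpa only [hb] using (mem_finsuppAntidiag.1 hl).1
    have hba : b = a := funext fun i => Finsupp.ext fun j => by
      rw [← sum_mapDomain_prodMk_apply b, hsum, sum_mapDomain_prodMk_apply]
    exact hne (Finsupp.ext fun i => by simp [← hb, hba])
  · intro hmem
    refine absurd (mem_finsuppAntidiag.2 ⟨?_, subset_univ _⟩) hmem
    simp only [Finsupp.equivFunOnFinite_symm_apply_apply]

theorem coeff_allOnes_prod (k m : ℕ) :
    coeff (allOnes k m) (∏ i : Fin k, inAlphabet i (elemSymm 1) ^ m) =
      (m.factorial : ℚ) ^ k := by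
  have hcoeff := coeff_sum_single_elemSymm_one_pow (range m)
  rw [card_range] at hcoeff
  have hallOnes : allOnes k m =
      ∑ i : Fin k, (∑ j ∈ range m, Finsupp.single j 1).mapDomain (Prod.mk i) := by
    simp only [allOnes, Finsupp.mapDomain_finsetSum, Finsupp.mapDomain_single]
  simp only [hallOnes, ← map_pow]
  rw [coeff_prod_inAlphabet, hcoeff, prod_const, card_univ, Fintype.card_fin]

end Coefficients

/-! ### Hadamard products over several alphabets -/

theorem jacobiTrudi_apply (R : SkewShape) (i j : Fin (R.outer.colLen 0)) :
    jacobiTrudi R i j = elemSymm (shiftedRowLen R.outer i - shiftedRowLen R.inner j) :=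
  congrArg elemSymm (by simp only [shiftedRowLen]; ring)

theorem det_hadamardPower_jacobiTrudi (k : ℕ) (R : SkewShape) :
    (hadamardPower k (jacobiTrudi R)).det =
      skewDet (fun d => ∏ i : Fin k, inAlphabet i (elemSymm d)) R := by
  refine congrArg Matrix.det (Matrix.ext fun i j => ?_)
  simp only [hadamardPower, Matrix.of_apply, jacobiTrudi_apply]

theorem sum_det_hadamardPower {k : ℕ} (hk : 1 ≤ k) (m : ℕ) :
    ∑ R ∈ ribbons m, (hadamardPower k (jacobiTrudi R)).det =
      ∏ i : Fin k, inAlphabet i (elemSymm 1) ^ m := by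
  simp only [det_hadamardPower_jacobiTrudi]
  rw [sum_skewDet_ribbons, Finset.prod_pow]
  · intro d hd
    exact Finset.prod_eq_zero (Finset.mem_univ ⟨0, hk⟩) (by rw [elemSymm_of_neg hd, map_zero])
  · exact Finset.prod_eq_one fun i _ => by rw [elemSymm_zero, map_one]

theorem schur_eq_skewDet (mu : YoungDiagram) :
    schur mu = skewDet elemSymm (SkewShape.straight mu.transpose) :=
  congrArg Matrix.det (Matrix.ext (jacobiTrudi_apply _))

theorem prod_sum_numSYT_smul_schur (k m : ℕ) :
    ∏ i : Fin k, ∑ mu ∈ partitionsOf m, (numSYT mu : ℚ) • inAlphabet i (schur mu) =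
      ∏ i : Fin k, inAlphabet i (elemSymm 1) ^ m := by
  refine Finset.prod_congr rfl fun i _ => ?_
  rw [← map_pow, ← sum_numSYT_smul_skewDet_straight_transpose (fun _ => elemSymm_of_neg)
    elemSymm_zero, map_sum]
  simp only [schur_eq_skewDet, map_nsmul, Nat.cast_smul_eq_nsmul]

end HadamardJT

theorem mainTheorem10 (k m : ℕ) (hk : 1 ≤ k) :
    (∑ R ∈ ribbons m, (hadamardPower k (jacobiTrudi R)).det
      = ∏ i : Fin k, ∑ mu ∈ partitionsOf m, (numSYT mu : ℚ) • inAlphabet i (schur mu)) ∧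
    MvPowerSeries.coeff (allOnes k m)
      (∑ R ∈ ribbons m, (hadamardPower k (jacobiTrudi R)).det) = ((m.factorial : ℚ)) ^ k ∧
    MvPowerSeries.coeff (allOnes k m)
      (∏ i : Fin k, ∑ mu ∈ partitionsOf m, (numSYT mu : ℚ) • inAlphabet i (schur mu))
      = ((m.factorial : ℚ)) ^ k := by
  rw [sum_det_hadamardPower hk, prod_sum_numSYT_smul_schur]
  exact ⟨rfl, coeff_allOnes_prod k m, coeff_allOnes_prod k m⟩
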